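/- There is an absolute constant $C>0$ such that for all $\varepsilon,\rho\in(0,1)$ and every integer $k\ge 1$ there is a number $q\le C\cdot\frac{k\log(k+1)}{\varepsilon^2\,\rho\,(1-\rho)^k}$ such that for every $n$ there is a non-adaptive quantum algorithm making $q$ queries to an unknown $n$-qubit unitary $U$, and no queries to $U^\dagger$, with the following guarantees for every $n$-qubit unitary $U$: (a) if $U$ is $\frac{\sqrt{\rho}}{8}\varepsilon$-close to some quantum $k$-junta, the algorithm accepts with probability at least $2/3$; (b) if $U$ is $\varepsilon$-far from every quantum $k$-junta, the algorithm rejects with probability at least $2/3$. Here an $n$-qubit unitary $V$ is a quantum $k$-junta if $V=V_T\otimes I_{\overline T}$ for some set $T$ of $k$ of the $n$ qubits and some operator $V_T$ acting on the qubits in $T$. With $N=2^n$ and $\|A\|_F=\sqrt{\mathrm{Tr}(A^\dagger A)}$, the distance is $\mathrm{dist}(U,V)=\min_{\theta\in[0,2\pi)}\frac{1}{\sqrt{2N}}\|e^{i\theta}U-V\|_F$; $U$ is $\delta$-close to $V$ if $\mathrm{dist}(U,V)\le\delta$ and $\delta$-far from $V$ if $\mathrm{dist}(U,V)>\delta$.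 A non-adaptive algorithm with $q$ queries prepares a (possibly mixed) state on $q$ registers of $n$ qubits and a finite-dimensional ancilla, applies $U^{\otimes q}\otimes I$, and performs a two-outcome measurement (accept/reject); the state and the measurement do not depend on $U$. -/

import Mathlib

open scoped Kronecker ComplexOrder

/-- Labels of the computational basis of `n` qubits. -/
abbrev Bits (n : ℕ) : Type := Fin n → Fin 2

/-- The group of all unitary operators on `n` qubits, as matrices in the computational basis. -/
abbrev QubitUnitary (n : ℕ) : Type := Matrix.unitaryGroup (Bits n) ℂ

/-- The Frobenius norm `√(Tr (A† A))`. -/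
noncomputable def frobNorm {ι : Type*} [Fintype ι] (A : Matrix ι ι ℂ) : ℝ :=
  Real.sqrt ((A.conjTranspose * A).trace.re)

/-- The distance up to global phase, `min_{θ ∈ [0, 2π)} ‖e^{iθ} A - B‖_F / √(2N)`, of two operators
on an `N`-dimensional space. -/
noncomputable def phaseDist {ι : Type*} [Fintype ι] (A B : Matrix ι ι ℂ) : ℝ :=
  ⨅ θ : Set.Ico (0 : ℝ) (2 * Real.pi),
    frobNorm (Complex.exp ((θ : ℝ) * Complex.I) • A - B) / Real.sqrt (2 * (Fintype.card ι : ℝ))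

/-- The infimum in `phaseDist` is a minimum. -/
theorem phaseDist_attained {ι : Type*} [Fintype ι] (A B : Matrix ι ι ℂ) :
    ∃ θ ∈ Set.Ico (0 : ℝ) (2 * Real.pi), phaseDist A B =
      frobNorm (Complex.exp ((θ : ℝ) * Complex.I) • A - B)
        / Real.sqrt (2 * (Fintype.card ι : ℝ)) := by
  have hpi : (0 : ℝ) < 2 * Real.pi := by positivity
  let f : ℝ → ℝ := fun θ => frobNorm (Complex.exp ((θ : ℝ) * Complex.I) • A - B)
        / Real.sqrt (2 * (Fintype.card ι : ℝ))
  have hf : Continuous f := by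
    unfold f frobNorm
    fun_prop
  have hper : f (2 * Real.pi) = f 0 := by
    simp [f, Complex.exp_two_pi_mul_I]
  obtain ⟨θ, hθ, hmin⟩ := isCompact_Icc.exists_isMinOn
    (Set.nonempty_Icc.mpr hpi.le) hf.continuousOn
  have key : ∃ t ∈ Set.Ico (0 : ℝ) (2 * Real.pi), f t = f θ := by
    rcases hθ.2.lt_or_eq with h | h
    · exact ⟨θ, ⟨hθ.1, h⟩, rfl⟩
    · exact ⟨0, ⟨le_rfl, hpi⟩, by rw [h, hper]⟩
  obtain ⟨t, ht, hft⟩ := key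
  refine ⟨t, ht, ?_⟩
  have : Nonempty (Set.Ico (0 : ℝ) (2 * Real.pi)) := ⟨⟨t, ht⟩⟩
  refine le_antisymm ?_ ?_
  · refine ciInf_le ⟨f θ, ?_⟩ (⟨t, ht⟩ : Set.Ico (0 : ℝ) (2 * Real.pi))
    rintro _ ⟨s, rfl⟩
    exact hmin ⟨s.2.1, s.2.2.le⟩
  · refine le_ciInf fun s => ?_
    change f t ≤ f s
    rw [hft]
    exact hmin ⟨s.2.1, s.2.2.le⟩

/-- `V` is a quantum junta on the set `T` of qubits: `V = V_T ⊗ I` with `V_T` acting on the qubits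
in `T` and `I` the identity on the remaining ones. -/
def IsQuantumJuntaOn {n : ℕ} (T : Finset (Fin n)) (V : QubitUnitary n) : Prop :=
  ∃ W : Matrix (T → Fin 2) (T → Fin 2) ℂ, ∀ x y : Bits n,
    (V : Matrix (Bits n) (Bits n) ℂ) x y =
      W (fun i => x i) (fun i => y i) * (if ∀ i, i ∉ T → x i = y i then 1 else 0)

/-- `V` is a quantum `k`-junta: a quantum junta on some set of `k` qubits. -/
def IsQuantumJunta {n : ℕ} (k : ℕ) (V : QubitUnitary n) : Prop :=
  ∃ T : Finset (Fin n), T.card = k ∧ IsQuantumJuntaOn T V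

/-- `U` is `δ`-close to some quantum `k`-junta. -/
def IsCloseToJunta {n : ℕ} (k : ℕ) (δ : ℝ) (U : QubitUnitary n) : Prop :=
  ∃ V : QubitUnitary n, IsQuantumJunta k V ∧
    phaseDist (U : Matrix (Bits n) (Bits n) ℂ) (V : Matrix (Bits n) (Bits n) ℂ) ≤ δ

/-- `U` is `δ`-far from every quantum `k`-junta. -/
def IsFarFromJuntas {n : ℕ} (k : ℕ) (δ : ℝ) (U : QubitUnitary n) : Prop :=
  ∀ V : QubitUnitary n, IsQuantumJunta k V →
    δ < phaseDist (U : Matrix (Bits n) (Bits n) ℂ) (V : Matrix (Bits n) (Bits n) ℂ)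

/-- The `q`-fold tensor power `U ⊗ ⋯ ⊗ U`, acting on `q` registers of `n` qubits each. -/
def tensorPower {n : ℕ} (q : ℕ) (U : QubitUnitary n) :
    Matrix (Fin q → Bits n) (Fin q → Bits n) ℂ :=
  fun x y => ∏ t, (U : Matrix (Bits n) (Bits n) ℂ) (x t) (y t)

/-- A non-adaptive quantum algorithm with accept/reject output that makes `q` queries to an unknown
`n`-qubit unitary `U`, and none to its inverse. It prepares a (possibly mixed) state `init`, which
does not depend on `U`, on `q` query registers and a finite-dimensional ancilla; the `q` queries
are made in parallel, one on each query register; then the joint system is measured by a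
two-outcome measurement `{accept, 1 - accept}`, which does not depend on `U` either. Internal
randomness and classical post-processing are part of the initial state and of the measurement. -/
structure NonadaptiveTester (n q : ℕ) where
  /-- Basis labels of the ancilla. -/
  Anc : Type
  [fintypeAnc : Fintype Anc]
  [decEqAnc : DecidableEq Anc]
  /-- Density matrix of the initial state. -/
  init : Matrix ((Fin q → Bits n) × Anc) ((Fin q → Bits n) × Anc) ℂ
  init_posSemidef : init.PosSemidef
  init_trace : init.trace = 1
  /-- Measurement operator of the outcome "accept". -/
  accept : Matrix ((Fin q → Bits n) × Anc) ((Fin q → Bits n) × Anc) ℂ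
  accept_posSemidef : accept.PosSemidef
  reject_posSemidef : (1 - accept).PosSemidef

namespace NonadaptiveTester

attribute [instance] NonadaptiveTester.fintypeAnc NonadaptiveTester.decEqAnc

/-- The state after the queries, `(U^{⊗q} ⊗ I) init (U^{⊗q} ⊗ I)†`. -/
noncomputable def finalState {n q : ℕ} (A : NonadaptiveTester n q) (U : QubitUnitary n) :
    Matrix ((Fin q → Bits n) × A.Anc) ((Fin q → Bits n) × A.Anc) ℂ :=
  (tensorPower q U ⊗ₖ (1 : Matrix A.Anc A.Anc ℂ)) * A.init *
    (tensorPower q U ⊗ₖ (1 : Matrix A.Anc A.Anc ℂ)).conjTranspose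

/-- The probability that the algorithm accepts `U` (Born rule). -/
noncomputable def acceptProb {n q : ℕ} (A : NonadaptiveTester n q) (U : QubitUnitary n) : ℝ :=
  (A.accept * A.finalState U).trace.re

/-- The probability that the algorithm rejects `U` (Born rule). -/
noncomputable def rejectProb {n q : ℕ} (A : NonadaptiveTester n q) (U : QubitUnitary n) : ℝ :=
  ((1 - A.accept) * A.finalState U).trace.re

end NonadaptiveTester

/-! Bell sampling of `U` (querying it on halves of maximally entangled states and measuring in the
Bell basis) returns a Pauli string `p` with probability `|Û(p)|²`, where `U = ∑ p, Û(p) σ_p`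
(`exists_bellSampling_tester`). A junta on `T` has only Pauli strings supported in `T`, and the
weight of `U` outside `T` is tied to the distance of `U` from these juntas:

* if `U` is `δ`-close to a junta on `T`, Parseval's identity bounds the weight outside `T` by `2 δ²`
  (`supportMass_ge_of_close`);
* conversely let `A` be the normalized partial trace of `U` onto `T`, a contraction. The unitary
  part `W` of its polar decomposition has `Re Tr (W† A) = ‖A‖₁ ≥ ‖A‖_F²`, so the junta `W ⊗ I` is at
  squared distance at most the weight outside `T` (`exists_junta_phaseDist_sq_le`).

It remains to decide, from samples of a random set, whether some `T` of size `k` fails to contain it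
with probability at most `ε² / 32`, or every such `T` with probability at least `ε²`. Taking
unions over blocks of about `4 / ε²` samples turns these probabilities into at most `5 / 32` and at
least `48 / 49`. The test accepts if some `T` contains at least half of `m` block unions. In the first
case Markov's inequality applies (`sum_not_halfCovered_le`). In the second case a covering `T` may be
replaced by the union of `k` of the block unions it contains (`HalfCovered.exists_generators`), so a
union bound over `m ^ k` families, in place of the `n`-dependent number of sets `T`, suffices
(`sum_halfCovered_le`); `m` of order `k log (k + 1)` is enough (`exists_block_count`). The resulting
number `O(k log (k + 1) / ε²)` of queries is within the claimed bound, as `ρ (1 - ρ) ^ k ≤ 1`. -/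

/-! ### Covering random sets by a set of size `k` -/

section Sampling

variable {Ω ι : Type*} [Fintype Ω] [DecidableEq ι]

theorem sum_prod_eq_one {κ : Type*} [Fintype κ] [DecidableEq κ] {w : Ω → ℝ}
    (hw1 : ∑ a, w a = 1) : ∑ Y : κ → Ω, ∏ i, w (Y i) = 1 := by
  rw [← Fintype.piFinset_univ, ← Finset.prod_univ_sum]
  simp [hw1]

/-- `supportMass w s T` is the probability that the random set `s a` is contained in `T`, where `a`
is drawn with probability `w a`. -/
def supportMass (w : Ω → ℝ) (s : Ω → Finset ι) (T : Finset ι) : ℝ :=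
  ∑ a, if s a ⊆ T then w a else 0

theorem supportMass_mono {w : Ω → ℝ} (hw : ∀ a, 0 ≤ w a) (s : Ω → Finset ι) {T T' : Finset ι}
    (h : T ⊆ T') : supportMass w s T ≤ supportMass w s T' := by
  refine Finset.sum_le_sum fun a _ => ?_
  split_ifs with h1 h2
  · exact le_rfl
  · exact absurd (h1.trans h) h2
  · exact hw a
  · exact le_rfl

/-- The union of `b` independent samples is in `T` exactly when each of them is. -/
theorem supportMass_biUnion (w : Ω → ℝ) (s : Ω → Finset ι) (T : Finset ι) (b : ℕ) :
    supportMass (fun Z : Fin b → Ω => ∏ j, w (Z j)) (fun Z => Finset.univ.biUnion fun j => s (Z j)) T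
      = supportMass w s T ^ b := by
  have : supportMass w s T ^ b = ∏ _j : Fin b, ∑ a, if s a ⊆ T then w a else 0 := by
    simp [supportMass]
  rw [this, Finset.prod_univ_sum, Fintype.piFinset_univ]
  refine Finset.sum_congr rfl fun Z _ => ?_
  simp only [Finset.biUnion_subset, Finset.mem_univ, true_implies]
  rw [Finset.prod_ite_zero]
  simp

/-- Acceptance criterion for a sequence of sets: some set of size `k` contains at least half of
them. -/
def HalfCovered {m : ℕ} (k : ℕ) (S : Fin m → Finset ι) : Prop :=
  ∃ T : Finset ι, T.card = k ∧ m ≤ 2 * (Finset.univ.filter fun i => S i ⊆ T).card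

open scoped Classical in
/-- Markov's inequality for the number of samples not contained in a given `T`. -/
theorem sum_not_halfCovered_le {w : Ω → ℝ} (hw : ∀ a, 0 ≤ w a) (hw1 : ∑ a, w a = 1)
    (s : Ω → Finset ι) {T : Finset ι} {m : ℕ} (hm : 0 < m) :
    ∑ Y : Fin m → Ω, (if HalfCovered T.card (fun i => s (Y i)) then 0 else ∏ i, w (Y i))
      ≤ 2 * (1 - supportMass w s T) := by
  have hone : ∀ i : Fin m, ∑ Y : Fin m → Ω, (if s (Y i) ⊆ T then 0 else ∏ j, w (Y j))
      = 1 - supportMass w s T := by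
    intro i
    have h1 : ∀ Y : Fin m → Ω, (if s (Y i) ⊆ T then 0 else ∏ j, w (Y j))
        = ∏ j, (if j = i ∧ s (Y j) ⊆ T then 0 else w (Y j)) := by
      intro Y
      split_ifs with h
      · exact (Finset.prod_eq_zero (Finset.mem_univ i) (by simp [h])).symm
      · refine Finset.prod_congr rfl fun j _ => ?_
        rw [if_neg]
        rintro ⟨rfl, h'⟩
        exact h h'
    rw [Finset.sum_congr rfl fun Y _ => h1 Y, ← Fintype.piFinset_univ,
      ← Finset.prod_univ_sum (fun _ => Finset.univ)
        (fun j a => if j = i ∧ s a ⊆ T then 0 else w a),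
      Finset.prod_eq_single i]
    · rw [supportMass, ← hw1, ← Finset.sum_sub_distrib]
      refine Finset.sum_congr rfl fun a _ => ?_
      by_cases h : s a ⊆ T <;> simp [h]
    · intro j _ hj
      simp [hj, hw1]
    · simp
  have hpos : (0 : ℝ) < m := by exact_mod_cast hm
  have key : ∑ Y : Fin m → Ω, (if HalfCovered T.card (fun i => s (Y i)) then 0 else ∏ i, w (Y i))
        * (m : ℝ) ≤ ∑ Y : Fin m → Ω, 2 * ∑ i, (if s (Y i) ⊆ T then 0 else ∏ j, w (Y j)) := by
    refine Finset.sum_le_sum fun Y _ => ?_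
    have hP : 0 ≤ ∏ j, w (Y j) := Finset.prod_nonneg fun j _ => hw _
    have hcnt : ∑ i, (if s (Y i) ⊆ T then 0 else ∏ j, w (Y j))
        = ((Finset.univ.filter fun i => ¬ s (Y i) ⊆ T).card : ℝ) * ∏ j, w (Y j) := by
      rw [← nsmul_eq_mul, ← Finset.sum_const, Finset.sum_filter]
      refine Finset.sum_congr rfl fun i _ => ?_
      by_cases h : s (Y i) ⊆ T <;> simp [h]
    rw [hcnt]
    split_ifs with h
    · rw [zero_mul]
      positivity
    · have h' : ¬ m ≤ 2 * (Finset.univ.filter fun i => s (Y i) ⊆ T).card :=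
        fun hh => h ⟨T, rfl, hh⟩
      have hadd := Finset.card_filter_add_card_filter_not (s := (Finset.univ : Finset (Fin m)))
        (fun i => s (Y i) ⊆ T)
      rw [Finset.card_univ, Fintype.card_fin] at hadd
      have : m ≤ 2 * (Finset.univ.filter fun i => ¬ s (Y i) ⊆ T).card := by omega
      have : (m : ℝ) ≤ 2 * ((Finset.univ.filter fun i => ¬ s (Y i) ⊆ T).card : ℝ) := by
        exact_mod_cast this
      nlinarith
  rw [← Finset.sum_mul, ← Finset.mul_sum, Finset.sum_comm, Finset.sum_congr rfl fun i _ => hone i]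
    at key
  simp only [Finset.sum_const, Finset.card_univ, Fintype.card_fin, nsmul_eq_mul] at key
  nlinarith

/-- If many of the sets `S i` fit in a set of size `k`, then those are already contained in the
union of `k` of them: choose one for each point of the covering set. -/
theorem HalfCovered.exists_generators {m k : ℕ} (hm : 0 < m) {S : Fin m → Finset ι}
    (h : HalfCovered k S) :
    ∃ f : Fin k → Fin m, (∃ T : Finset ι, T.card = k ∧ (Finset.univ.biUnion fun j => S (f j)) ⊆ T) ∧
      m ≤ 2 * (Finset.univ.filter fun i => S i ⊆ Finset.univ.biUnion fun j => S (f j)).card := by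
  classical
  obtain ⟨T, hT, hcard⟩ := h
  have hne : (Finset.univ.filter fun i => S i ⊆ T).Nonempty := by
    rw [← Finset.card_pos]
    omega
  obtain ⟨i₀, hi₀⟩ := hne
  have hi₀ : S i₀ ⊆ T := by simpa using hi₀
  have hsel : ∀ t : ι, ∃ i, S i ⊆ T ∧ ((∃ i', S i' ⊆ T ∧ t ∈ S i') → t ∈ S i) := by
    intro t
    by_cases ht : ∃ i', S i' ⊆ T ∧ t ∈ S i'
    · obtain ⟨i', h1, h2⟩ := ht
      exact ⟨i', h1, fun _ => h2⟩
    · exact ⟨i₀, hi₀, fun h => absurd h ht⟩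
  choose g hgT hg using hsel
  let e := T.equivFinOfCardEq hT
  refine ⟨fun j => g (e.symm j), ⟨T, hT, ?_⟩, hcard.trans ?_⟩
  · exact Finset.biUnion_subset.2 fun j _ => hgT _
  · refine Nat.mul_le_mul_left 2 (Finset.card_le_card fun i hi => ?_)
    rw [Finset.mem_filter] at hi ⊢
    refine ⟨hi.1, fun t ht => ?_⟩
    replace hi := hi.2
    refine Finset.mem_biUnion.2 ⟨e ⟨t, hi ht⟩, Finset.mem_univ _, ?_⟩
    simpa using hg t ⟨i, hi, ht⟩

/-- Integrating out the coordinates outside the range of `f`, when the weight `h`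
of each of them has conditional expectation at most `c` given the coordinates in the range of `f`. -/
theorem sum_prod_outside_range_le {w : Ω → ℝ} (hw : ∀ a, 0 ≤ w a) (hw1 : ∑ a, w a = 1)
    {m k : ℕ} (f : Fin k → Fin m) (F : (Fin k → Ω) → Prop) [DecidablePred F]
    (h : (Fin k → Ω) → Ω → ℝ) (hh : ∀ Z a, 0 ≤ h Z a) {c : ℝ} (hc : 1 ≤ c)
    (hF : ∀ Z, F Z → ∑ a, w a * h Z a ≤ c) :
    ∑ Y : Fin m → Ω, (if F (fun j => Y (f j)) then
        (∏ i, w (Y i)) * ∏ i, (if i ∈ Set.range f then 1 else h (fun j => Y (f j)) (Y i)) else 0)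
      ≤ c ^ m := by
  classical
  let e := Equiv.piEquivPiSubtypeProd (fun i => i ∈ Set.range f) (fun _ : Fin m => Ω)
  let r : Fin k → {i // i ∈ Set.range f} := fun j => ⟨f j, j, rfl⟩
  rw [← e.symm.sum_comp, Fintype.sum_prod_type]
  have hc0 : 0 ≤ c := zero_le_one.trans hc
  have hbound : ∀ Z : {i // i ∈ Set.range f} → Ω,
      ∑ Z' : {i // i ∉ Set.range f} → Ω, (if F (fun j => e.symm (Z, Z') (f j)) then
        (∏ i, w (e.symm (Z, Z') i)) * ∏ i, (if i ∈ Set.range f then 1 else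
          h (fun j => e.symm (Z, Z') (f j)) (e.symm (Z, Z') i)) else 0)
      ≤ (∏ i, w (Z i)) * c ^ m := by
    intro Z
    have hw0 : 0 ≤ ∏ i, w (Z i) := Finset.prod_nonneg fun i _ => hw _
    have hr : ∀ Z' : {i // i ∉ Set.range f} → Ω, (fun j => e.symm (Z, Z') (f j)) = Z ∘ r := by
      intro Z'
      funext j
      simp [e, r, Equiv.piEquivPiSubtypeProd]
    by_cases hZ : F (Z ∘ r)
    · have hterm : ∀ Z' : {i // i ∉ Set.range f} → Ω,
          (if F (fun j => e.symm (Z, Z') (f j)) then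
          (∏ i, w (e.symm (Z, Z') i)) * ∏ i, (if i ∈ Set.range f then 1 else
            h (fun j => e.symm (Z, Z') (f j)) (e.symm (Z, Z') i)) else 0)
          = (∏ i, w (Z i)) * ∏ i, (w (Z' i) * h (Z ∘ r) (Z' i)) := by
        intro Z'
        rw [hr Z', if_pos hZ, ← Finset.prod_mul_distrib,
          ← Fintype.prod_subtype_mul_prod_subtype (fun i => i ∈ Set.range f)]
        congr 1
        · refine Finset.prod_congr (by ext; simp) fun i _ => ?_
          have hi := i.2
          rw [if_pos hi, mul_one]
          simp only [e, Equiv.piEquivPiSubtypeProd, Equiv.coe_fn_symm_mk, dif_pos hi]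
        · refine Finset.prod_congr rfl fun i _ => ?_
          have hi := i.2
          rw [if_neg hi]
          simp only [e, Equiv.piEquivPiSubtypeProd, Equiv.coe_fn_symm_mk, dif_neg hi]
      rw [Finset.sum_congr rfl fun Z' _ => hterm Z', ← Finset.mul_sum]
      refine mul_le_mul_of_nonneg_left ?_ hw0
      rw [← Fintype.piFinset_univ, ← Finset.prod_univ_sum (fun _ => Finset.univ)
        (fun _ a => w a * h (Z ∘ r) a), Finset.prod_const, Finset.card_univ]
      refine (pow_le_pow_left₀ (Finset.sum_nonneg fun a _ => mul_nonneg (hw a) (hh _ a))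
        (hF _ hZ) _).trans (pow_le_pow_right₀ hc ?_)
      exact (Fintype.card_subtype_le _).trans (Fintype.card_fin m).le
    · rw [Finset.sum_eq_zero]
      · positivity
      · intro Z' _
        rw [hr Z', if_neg hZ]
  refine (Finset.sum_le_sum fun Z _ => hbound Z).trans ?_
  rw [← Finset.sum_mul, sum_prod_eq_one hw1, one_mul]

open scoped Classical in
/-- If no set of size `k` contains the random set with probability more than `1 / 49`, then `m`
independent samples are rarely half covered. The bound combines a union bound over the `m ^ k`
possible generating families with an exponential moment, weight `49` being given to each sample
that falls in the union of the generators. -/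
theorem sum_halfCovered_le {w : Ω → ℝ} (hw : ∀ a, 0 ≤ w a) (hw1 : ∑ a, w a = 1)
    (s : Ω → Finset ι) {k m : ℕ} (hm : 0 < m)
    (hs : ∀ T : Finset ι, T.card = k → supportMass w s T ≤ 1 / 49) :
    ∑ Y : Fin m → Ω, (if HalfCovered k (fun i => s (Y i)) then ∏ i, w (Y i) else 0)
      ≤ (49 * m) ^ k * (2 / 7) ^ m := by
  let F : (Fin k → Ω) → Prop := fun Z =>
    ∃ T : Finset ι, T.card = k ∧ (Finset.univ.biUnion fun j => s (Z j)) ⊆ T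
  let h : (Fin k → Ω) → Ω → ℝ := fun Z a =>
    if s a ⊆ Finset.univ.biUnion fun j => s (Z j) then 49 else 1
  have hh1 : ∀ Z a, 1 ≤ h Z a := by
    intro Z a
    simp only [h]
    split_ifs <;> norm_num
  have hF : ∀ Z, F Z → ∑ a, w a * h Z a ≤ 2 := by
    rintro Z ⟨T, hT, hsub⟩
    have h1 := (supportMass_mono hw s hsub).trans (hs T hT)
    have h2 : ∑ a, w a * h Z a
        = 1 + 48 * supportMass w s (Finset.univ.biUnion fun j => s (Z j)) := by
      rw [supportMass, ← hw1, Finset.mul_sum, ← Finset.sum_add_distrib]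
      refine Finset.sum_congr rfl fun a _ => ?_
      simp only [h]
      split_ifs <;> ring
    linarith
  let term : (Fin k → Fin m) → (Fin m → Ω) → ℝ := fun f Y =>
    if F (fun j => Y (f j)) then
        (∏ i, w (Y i)) * ∏ i, (if i ∈ Set.range f then 1 else h (fun j => Y (f j)) (Y i)) else 0
  have hterm : ∀ f Y, 0 ≤ term f Y := by
    intro f Y
    simp only [term]
    split_ifs
    · refine mul_nonneg (Finset.prod_nonneg fun i _ => hw _) (Finset.prod_nonneg fun i _ => ?_)
      split_ifs
      · exact zero_le_one
      · exact zero_le_one.trans (hh1 _ _)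
    · exact le_rfl
  have hpt : ∀ Y : Fin m → Ω, (if HalfCovered k (fun i => s (Y i)) then ∏ i, w (Y i) else 0)
      * 7 ^ m ≤ 49 ^ k * ∑ f, term f Y := by
    intro Y
    split_ifs with hY
    · obtain ⟨f, hfF, hf⟩ := hY.exists_generators hm
      have h1 : 49 ^ k * term f Y ≤ 49 ^ k * ∑ f, term f Y :=
        mul_le_mul_of_nonneg_left
          (Finset.single_le_sum (fun f _ => hterm f Y) (Finset.mem_univ f)) (by positivity)
      refine le_trans ?_ h1
      have hw0 : 0 ≤ ∏ i, w (Y i) := Finset.prod_nonneg fun i _ => hw _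
      have hterm_eq : term f Y = (∏ i, w (Y i)) *
          ∏ i, (if i ∈ Set.range f then 1 else h (fun j => Y (f j)) (Y i)) := if_pos hfF
      rw [hterm_eq, mul_left_comm]
      refine mul_le_mul_of_nonneg_left ?_ hw0
      -- At most `k` of the covered samples are generators; each of the others contributes `49`.
      have hrange : ∏ i : Fin m, (if i ∈ Set.range f then (49 : ℝ) else 1) ≤ 49 ^ k := by
        rw [← Finset.prod_filter, Finset.prod_const]
        refine pow_le_pow_right₀ (by norm_num) ?_
        have : (Finset.univ.filter fun i => i ∈ Set.range f) = Finset.univ.image f := by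
          ext i; simp
        rw [this]
        exact Finset.card_image_le.trans (by simp)
      have hcov : (7 : ℝ) ^ m ≤ ∏ i, h (fun j => Y (f j)) (Y i) := by
        simp only [h]
        rw [← Finset.prod_filter, Finset.prod_const]
        calc (7 : ℝ) ^ m ≤ 7 ^ (2 * (Finset.univ.filter fun i =>
              s (Y i) ⊆ Finset.univ.biUnion fun j => s (Y (f j))).card) :=
              pow_le_pow_right₀ (by norm_num) hf
          _ = _ := by rw [pow_mul]; norm_num
      have hsplit : ∏ i, h (fun j => Y (f j)) (Y i) ≤
          (∏ i : Fin m, (if i ∈ Set.range f then (49 : ℝ) else 1)) *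
          ∏ i, (if i ∈ Set.range f then 1 else h (fun j => Y (f j)) (Y i)) := by
        rw [← Finset.prod_mul_distrib]
        refine Finset.prod_le_prod (fun i _ => zero_le_one.trans (hh1 _ _)) fun i _ => ?_
        split_ifs
        · simp only [h]
          split_ifs <;> norm_num
        · simp
      refine (hcov.trans hsplit).trans (mul_le_mul_of_nonneg_right hrange ?_)
      refine Finset.prod_nonneg fun i _ => ?_
      split_ifs
      · exact zero_le_one
      · exact zero_le_one.trans (hh1 _ _)
    · rw [zero_mul]
      exact mul_nonneg (by positivity) (Finset.sum_nonneg fun f _ => hterm f Y)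
  have hsum := Finset.sum_le_sum fun Y (_ : Y ∈ (Finset.univ : Finset (Fin m → Ω))) => hpt Y
  rw [← Finset.sum_mul, ← Finset.mul_sum, Finset.sum_comm] at hsum
  have hf : ∑ f, ∑ Y, term f Y ≤ (m : ℝ) ^ k * 2 ^ m := by
    refine (Finset.sum_le_sum fun f _ => sum_prod_outside_range_le hw hw1 f F h
      (fun Z a => zero_le_one.trans (hh1 Z a)) (c := 2) (by norm_num) hF).trans ?_
    simp
  rw [mul_pow, div_pow, mul_div_assoc', le_div_iff₀ (by positivity), mul_assoc]
  exact hsum.trans (mul_le_mul_of_nonneg_left hf (by positivity))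

end Sampling

/-- The number of blocks: since `(2 / 7) ^ m ≤ exp (-m)`, order `k log (k + 1)` blocks beat the
union bound over `m ^ k` families. -/
theorem exists_block_count {k : ℕ} (hk : 1 ≤ k) :
    ∃ m : ℕ, 0 < m ∧ (m : ℝ) ≤ 22 * (k * Real.log (k + 1)) ∧
      (49 * (m : ℝ)) ^ k * (2 / 7) ^ m ≤ 1 / 3 := by
  have hk1 : (1 : ℝ) ≤ k := by exact_mod_cast hk
  set L := Real.log ((k : ℝ) + 1) with hL
  have hL2 : 0.69 ≤ L := by
    have h1 := Real.log_two_gt_d9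
    have h2 : Real.log 2 ≤ L := Real.log_le_log (by norm_num) (by linarith)
    linarith
  have hkL : 0.69 ≤ k * L := by nlinarith
  refine ⟨⌈20 * (k * L)⌉₊, Nat.ceil_pos.2 (by linarith), ?_, ?_⟩
  · have := Nat.ceil_lt_add_one (show 0 ≤ 20 * (k * L) by linarith)
    linarith
  · have hm := Nat.le_ceil (20 * (k * L))
    set m := ⌈20 * (k * L)⌉₊
    have hm0 : (0 : ℝ) < m := by linarith
    have he := Real.exp_one_lt_d9
    have he' := Real.exp_one_gt_d9
    have h49 : (49 : ℝ) ≤ Real.exp 4 := by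
      rw [show (4 : ℝ) = ((4 : ℕ) : ℝ) * 1 by norm_num, Real.exp_nat_mul]
      have : (2.7 : ℝ) ^ 4 ≤ Real.exp 1 ^ 4 := pow_le_pow_left₀ (by norm_num) (by linarith) 4
      linarith
    have hm_exp : (m : ℝ) ≤ Real.exp (m / (2 * k) + L) := by
      -- `log x ≤ x / 2` at `x = m / k`
      have h1 : (m : ℝ) / k ≤ Real.exp (m / (2 * k)) := by
        have h2 := Real.add_one_le_exp ((m : ℝ) / (2 * k) - 1)
        rw [Real.exp_sub, sub_add_cancel, le_div_iff₀ (Real.exp_pos _)] at h2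
        have h3 : (m : ℝ) / k = m / (2 * k) * 2 := by field_simp
        have h4 : 0 ≤ (m : ℝ) / (2 * k) := by positivity
        rw [h3]
        nlinarith
      rw [Real.exp_add, hL, Real.exp_log (by positivity)]
      rw [div_le_iff₀ (by positivity)] at h1
      nlinarith [Real.exp_pos ((m : ℝ) / (2 * k))]
    have h27 : (2 / 7 : ℝ) ≤ Real.exp (-1) := by
      rw [Real.exp_neg, le_inv_comm₀ (by norm_num) (Real.exp_pos _)]
      norm_num
      linarith
    calc (49 * (m : ℝ)) ^ k * (2 / 7) ^ m
        ≤ (Real.exp 4 * Real.exp (m / (2 * k) + L)) ^ k * Real.exp (-1) ^ m := by gcongr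
      _ = Real.exp (4 * k + k * L - m / 2) := by
          rw [← Real.exp_add, ← Real.exp_nat_mul, ← Real.exp_nat_mul, ← Real.exp_add]
          congr 1
          field_simp
          ring
      _ ≤ Real.exp (-2) := Real.exp_le_exp.2 (by nlinarith)
      _ ≤ 1 / 3 := by
          rw [Real.exp_neg, inv_eq_one_div]
          refine one_div_le_one_div_of_le (by norm_num) ?_
          have := Real.add_one_le_exp (2 : ℝ)
          linarith

/-! ### Pauli strings and Bell sampling -/

section PauliStrings

open Matrix

/-- The single-qubit Pauli matrices `I, X, Y, Z`. -/
noncomputable def pauli : Fin 4 → Matrix (Fin 2) (Fin 2) ℂ :=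
  ![1, !![0, 1; 1, 0], !![0, -Complex.I; Complex.I, 0], !![1, 0; 0, -1]]

theorem sum_pauli_mul_star (x y x' y' : Fin 2) :
    ∑ a, pauli a x y * star (pauli a x' y') = if x = x' ∧ y = y' then 2 else 0 := by
  fin_cases x <;> fin_cases y <;> fin_cases x' <;> fin_cases y' <;>
    simp [Fin.sum_univ_four, pauli] <;> norm_num

theorem sum_star_pauli_diag {a : Fin 4} (ha : a ≠ 0) : ∑ z, star (pauli a z z) = 0 := by
  fin_cases a <;> simp_all [pauli]

theorem pauli_zero : pauli 0 = 1 := rfl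

variable {ι : Type*} [Fintype ι]

/-- The tensor product of the Pauli matrices `p i`, over the qubits `i`. -/
noncomputable def pauliString (p : ι → Fin 4) : Matrix (ι → Fin 2) (ι → Fin 2) ℂ :=
  fun x y => ∏ i, pauli (p i) (x i) (y i)

variable [DecidableEq ι]

theorem sum_pauliString_mul_star (x y x' y' : ι → Fin 2) :
    ∑ p, pauliString p x y * star (pauliString p x' y')
      = if x = x' ∧ y = y' then 2 ^ Fintype.card ι else 0 := by
  have h : ∀ p : ι → Fin 4, pauliString p x y * star (pauliString p x' y')
      = ∏ i, pauli (p i) (x i) (y i) * star (pauli (p i) (x' i) (y' i)) := by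
    intro p
    rw [pauliString, pauliString, star_prod, Finset.prod_mul_distrib]
  rw [Finset.sum_congr rfl fun p _ => h p, ← Fintype.piFinset_univ,
    ← Finset.prod_univ_sum (fun _ => Finset.univ)
      (fun i a => pauli a (x i) (y i) * star (pauli a (x' i) (y' i)))]
  simp only [sum_pauli_mul_star]
  rw [Finset.prod_ite_zero]
  simp [funext_iff, forall_and]

/-- The coefficient of `M` along the Pauli string `p`, that is `Tr (σ_p† M) / 2 ^ |ι|`. -/
noncomputable def pauliCoeff (M : Matrix (ι → Fin 2) (ι → Fin 2) ℂ) (p : ι → Fin 4) : ℂ :=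
  (∑ z : (ι → Fin 2) × (ι → Fin 2), star (pauliString p z.1 z.2) * M z.1 z.2)
    / 2 ^ Fintype.card ι

/-- The weight `|M̂(p)|²` of `M` on the Pauli string `p`. For unitary `M` these weights are the
outcome probabilities of a Bell-basis measurement of the Choi state of `M`. -/
noncomputable def pauliWeight (M : Matrix (ι → Fin 2) (ι → Fin 2) ℂ) (p : ι → Fin 4) : ℝ :=
  Complex.normSq (pauliCoeff M p)

theorem pauliWeight_nonneg (M : Matrix (ι → Fin 2) (ι → Fin 2) ℂ) (p : ι → Fin 4) :
    0 ≤ pauliWeight M p := Complex.normSq_nonneg _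

theorem parseval_of_completeness {I Z : Type*} [Fintype I] [Fintype Z] [DecidableEq Z]
    (B : I → Z → ℂ) (c : ℝ)
    (hB : ∀ z z', ∑ i, B i z * star (B i z') = if z = z' then (c : ℂ) else 0) (M : Z → ℂ) :
    ∑ i, Complex.normSq (∑ z, star (B i z) * M z) = c * ∑ z, Complex.normSq (M z) := by
  rw [← Complex.ofReal_inj]
  push_cast
  have h : ∀ i, (Complex.normSq (∑ z, star (B i z) * M z) : ℂ)
      = ∑ z, ∑ z', M z * star (M z') * (B i z' * star (B i z)) := by
    intro i
    rw [Complex.normSq_eq_conj_mul_self, mul_comm, map_sum, Finset.sum_mul_sum]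
    refine Finset.sum_congr rfl fun z _ => Finset.sum_congr rfl fun z' _ => ?_
    simp
    ring
  rw [Finset.sum_congr rfl fun i _ => h i, Finset.sum_comm, Finset.mul_sum]
  refine Finset.sum_congr rfl fun z _ => ?_
  rw [Finset.sum_comm]
  simp only [← Finset.mul_sum, hB]
  simp [Complex.normSq_eq_conj_mul_self]
  ring

theorem sum_pauliWeight (M : Matrix (ι → Fin 2) (ι → Fin 2) ℂ) :
    ∑ p, pauliWeight M p = (∑ x, ∑ y, Complex.normSq (M x y)) / 2 ^ Fintype.card ι := by
  have h := parseval_of_completeness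
    (fun (p : ι → Fin 4) (z : (ι → Fin 2) × (ι → Fin 2)) => pauliString p z.1 z.2)
    (2 ^ Fintype.card ι) (by
      intro z z'
      rw [sum_pauliString_mul_star]
      simp [Prod.ext_iff]) (fun z => M z.1 z.2)
  rw [Fintype.sum_prod_type] at h
  simp only [pauliWeight, pauliCoeff, map_div₀, map_pow, ← Finset.sum_div]
  rw [h, Complex.normSq_ofNat, mul_pow]
  field_simp

theorem sum_normSq_unitary {κ : Type*} [Fintype κ] [DecidableEq κ] {U : Matrix κ κ ℂ}
    (hU : U ∈ Matrix.unitaryGroup κ ℂ) :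
    ∑ x, ∑ y, Complex.normSq (U x y) = Fintype.card κ := by
  have hrow : ∀ x, ∑ y, Complex.normSq (U x y) = 1 := by
    intro x
    have h := congr_fun₂ (Matrix.mem_unitaryGroup_iff.1 hU) x x
    rw [Matrix.mul_apply, Matrix.one_apply_eq] at h
    rw [← Complex.ofReal_inj]
    push_cast
    rw [← h]
    refine Finset.sum_congr rfl fun y _ => ?_
    rw [Matrix.star_apply, mul_comm]
    exact Complex.normSq_eq_conj_mul_self
  rw [Finset.sum_congr rfl fun x _ => hrow x]
  simp

theorem sum_pauliWeight_unitary {U : Matrix (ι → Fin 2) (ι → Fin 2) ℂ}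
    (hU : U ∈ Matrix.unitaryGroup (ι → Fin 2) ℂ) : ∑ p, pauliWeight U p = 1 := by
  rw [sum_pauliWeight, sum_normSq_unitary hU]
  simp

end PauliStrings

section BellSampling

open Matrix

theorem trace_sum_vecMulVec_mul {I Z : Type*} [Fintype Z] (s : Finset I) (v : I → Z → ℂ)
    (u : Z → ℂ) :
    ((∑ i ∈ s, vecMulVec (v i) (star (v i))) * vecMulVec u (star u)).trace.re
      = ∑ i ∈ s, Complex.normSq (∑ z, star (v i z) * u z) := by
  rw [Finset.sum_mul, Matrix.trace_sum, Complex.re_sum]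
  refine Finset.sum_congr rfl fun i _ => ?_
  rw [vecMulVec_mul_vecMulVec, Matrix.trace_vecMulVec]
  have h1 : star (v i) ⬝ᵥ u = ∑ z, star (v i z) * u z := rfl
  have h2 : v i ⬝ᵥ ((star (v i) ⬝ᵥ u) • star u)
      = (star (v i) ⬝ᵥ u) * star (star (v i) ⬝ᵥ u) := by
    rw [dotProduct_smul, smul_eq_mul]
    congr 1
    simp [dotProduct, mul_comm]
  rw [h2, h1, Complex.star_def, Complex.mul_conj, Complex.ofReal_re]

theorem sqrt_two_pow_mul_self (n q : ℕ) :
    ((Real.sqrt (2 ^ (n * q)) : ℝ) : ℂ) * (Real.sqrt (2 ^ (n * q)) : ℝ) = (2 ^ n) ^ q := by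
  rw [← Complex.ofReal_mul, Real.mul_self_sqrt (by positivity), ← pow_mul]
  push_cast
  rfl

/-- Vector of the Bell-basis outcome `σ` on `q` pairs of registers: the normalized vectorizations
of the Pauli strings `σ t`. -/
noncomputable def bellVector {n q : ℕ} (σ : Fin q → Fin n → Fin 4) :
    (Fin q → Bits n) × (Fin q → Bits n) → ℂ :=
  fun z => (∏ t, pauliString (σ t) (z.1 t) (z.2 t)) / (Real.sqrt (2 ^ (n * q)) : ℝ)

theorem sum_bellVector_mul_star {n q : ℕ} (z z' : (Fin q → Bits n) × (Fin q → Bits n)) :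
    ∑ σ, bellVector σ z * star (bellVector σ z') = if z = z' then 1 else 0 := by
  have h : ∀ σ : Fin q → Fin n → Fin 4, bellVector σ z * star (bellVector σ z')
      = (∏ t, pauliString (σ t) (z.1 t) (z.2 t) * star (pauliString (σ t) (z'.1 t) (z'.2 t)))
        / (2 ^ n) ^ q := by
    intro σ
    rw [bellVector, bellVector, star_div₀, star_prod, Complex.star_def, Complex.conj_ofReal,
      div_mul_div_comm, sqrt_two_pow_mul_self, Finset.prod_mul_distrib]
  rw [Finset.sum_congr rfl fun σ _ => h σ, ← Finset.sum_div, ← Fintype.piFinset_univ,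
    ← Finset.prod_univ_sum (fun _ => Finset.univ)
      (fun t p => pauliString p (z.1 t) (z.2 t) * star (pauliString p (z'.1 t) (z'.2 t)))]
  simp only [sum_pauliString_mul_star]
  rw [Finset.prod_ite_zero]
  simp [Prod.ext_iff, funext_iff, forall_and, ite_div]

/-- Bell sampling: querying `U` on halves of maximally entangled states and measuring in the Bell
basis yields independent Pauli strings distributed according to the weights of `U`, so every
classical test of `q` such samples is a tester with `q` non-adaptive queries. -/
theorem exists_bellSampling_tester (n q : ℕ) (S : Finset (Fin q → Fin n → Fin 4)) :
    ∃ A : NonadaptiveTester n q, ∀ U : QubitUnitary n,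
      A.acceptProb U = ∑ σ ∈ S, ∏ t, pauliWeight (U : Matrix (Bits n) (Bits n) ℂ) (σ t) ∧
      A.rejectProb U = ∑ σ ∈ Sᶜ, ∏ t, pauliWeight (U : Matrix (Bits n) (Bits n) ℂ) (σ t) := by
  classical
  let φ : (Fin q → Bits n) × (Fin q → Bits n) → ℂ :=
    fun z => (if z.1 = z.2 then 1 else 0) / (Real.sqrt (2 ^ (n * q)) : ℝ)
  let P : Finset (Fin q → Fin n → Fin 4) →
      Matrix ((Fin q → Bits n) × (Fin q → Bits n)) ((Fin q → Bits n) × (Fin q → Bits n)) ℂ :=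
    fun S => ∑ σ ∈ S, vecMulVec (bellVector σ) (star (bellVector σ))
  have hP : ∀ S, (P S).PosSemidef := fun S =>
    Matrix.posSemidef_sum _ fun σ _ => posSemidef_vecMulVec_self_star _
  have hcompl : 1 - P S = P Sᶜ := by
    rw [sub_eq_iff_eq_add, add_comm]
    simp only [P]
    rw [Finset.sum_add_sum_compl]
    ext z z'
    rw [Matrix.sum_apply, Matrix.one_apply, ← sum_bellVector_mul_star]
    rfl
  have hφ : φ ⬝ᵥ star φ = 1 := by
    have h : ∀ z, φ z * star φ z = (if z.1 = z.2 then 1 else 0) / (2 ^ n) ^ q := by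
      intro z
      simp only [φ, Pi.star_apply]
      rw [star_div₀, Complex.star_def, Complex.conj_ofReal, div_mul_div_comm,
        sqrt_two_pow_mul_self]
      split_ifs <;> simp
    rw [dotProduct, Finset.sum_congr rfl fun z _ => h z, ← Finset.sum_div, Fintype.sum_prod_type]
    simp
  have hout : ∀ (U : QubitUnitary n) (σ : Fin q → Fin n → Fin 4),
      Complex.normSq (∑ z, star (bellVector σ z) *
        ((tensorPower q U ⊗ₖ (1 : Matrix (Fin q → Bits n) (Fin q → Bits n) ℂ)) *ᵥ φ) z)
      = ∏ t, pauliWeight (U : Matrix (Bits n) (Bits n) ℂ) (σ t) := by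
    intro U σ
    have hK : ∀ z, ((tensorPower q U ⊗ₖ (1 : Matrix (Fin q → Bits n) (Fin q → Bits n) ℂ)) *ᵥ φ) z
        = tensorPower q U z.1 z.2 / (Real.sqrt (2 ^ (n * q)) : ℝ) := by
      intro z
      rw [mulVec, dotProduct, Fintype.sum_prod_type]
      simp [φ, Matrix.kroneckerMap_apply, Matrix.one_apply, div_eq_mul_inv]
    have hterm : ∀ z : (Fin q → Bits n) × (Fin q → Bits n), star (bellVector σ z) *
        (tensorPower q U z.1 z.2 / (Real.sqrt (2 ^ (n * q)) : ℝ))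
        = (∏ t, star (pauliString (σ t) (z.1 t) (z.2 t)) *
          (U : Matrix (Bits n) (Bits n) ℂ) (z.1 t) (z.2 t)) / (2 ^ n) ^ q := by
      intro z
      rw [bellVector, tensorPower, star_div₀, star_prod, Complex.star_def, Complex.conj_ofReal,
        div_mul_div_comm, sqrt_two_pow_mul_self, Finset.prod_mul_distrib]
    rw [Finset.sum_congr rfl fun z _ => by rw [hK z, hterm z], ← Finset.sum_div,
      ← (Equiv.arrowProdEquivProdArrow (Fin q) (fun _ => Bits n) (fun _ => Bits n)).sum_comp]
    simp only [Equiv.arrowProdEquivProdArrow_apply]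
    rw [← Fintype.piFinset_univ, ← Finset.prod_univ_sum (fun _ => Finset.univ)
      (fun t (z : Bits n × Bits n) =>
        star (pauliString (σ t) z.1 z.2) * (U : Matrix (Bits n) (Bits n) ℂ) z.1 z.2)]
    simp only [pauliWeight, pauliCoeff, ← map_prod, Finset.prod_div_distrib]
    simp
  have hfinal : ∀ (U : QubitUnitary n) (S : Finset (Fin q → Fin n → Fin 4)),
      (P S * ((tensorPower q U ⊗ₖ (1 : Matrix (Fin q → Bits n) (Fin q → Bits n) ℂ)) *
        vecMulVec φ (star φ) * (tensorPower q U ⊗ₖ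
          (1 : Matrix (Fin q → Bits n) (Fin q → Bits n) ℂ)).conjTranspose)).trace.re
      = ∑ σ ∈ S, ∏ t, pauliWeight (U : Matrix (Bits n) (Bits n) ℂ) (σ t) := by
    intro U S
    rw [mul_vecMulVec, vecMulVec_mul, ← star_mulVec, trace_sum_vecMulVec_mul]
    exact Finset.sum_congr rfl fun σ _ => hout U σ
  refine ⟨{ Anc := Fin q → Bits n
            init := vecMulVec φ (star φ)
            init_posSemidef := posSemidef_vecMulVec_self_star _
            init_trace := by rw [Matrix.trace_vecMulVec, hφ]
            accept := P S
            accept_posSemidef := hP S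
            reject_posSemidef := by rw [hcompl]; exact hP _ }, fun U => ⟨hfinal U S, ?_⟩⟩
  have h := hfinal U Sᶜ
  rw [← hcompl] at h
  exact h

end BellSampling

/-! ### Contractions, polar decomposition and partial trace -/

section Contractions

open Matrix

theorem dotProduct_star_self_re {κ : Type*} [Fintype κ] (v : κ → ℂ) :
    (star v ⬝ᵥ v).re = ∑ i, Complex.normSq (v i) := by
  rw [dotProduct, Complex.re_sum]
  refine Finset.sum_congr rfl fun i _ => ?_
  rw [Pi.star_apply, Complex.star_def, ← Complex.normSq_eq_conj_mul_self, Complex.ofReal_re]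

theorem trace_conjTranspose_mul_self_re {κ : Type*} [Fintype κ] (A : Matrix κ κ ℂ) :
    (Aᴴ * A).trace.re = ∑ x, ∑ y, Complex.normSq (A x y) := by
  rw [Finset.sum_comm, trace, Complex.re_sum]
  exact Finset.sum_congr rfl fun y _ => dotProduct_star_self_re fun x => A x y

theorem frobNorm_sq {κ : Type*} [Fintype κ] (A : Matrix κ κ ℂ) :
    frobNorm A ^ 2 = ∑ x, ∑ y, Complex.normSq (A x y) := by
  rw [frobNorm, trace_conjTranspose_mul_self_re, Real.sq_sqrt]
  exact Finset.sum_nonneg fun x _ => Finset.sum_nonneg fun y _ => Complex.normSq_nonneg _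

variable {κ : Type*} [Fintype κ] [DecidableEq κ]

theorem mulVec_unitary_normSq {U : Matrix κ κ ℂ} (hU : U ∈ unitaryGroup κ ℂ) (v : κ → ℂ) :
    ∑ i, Complex.normSq ((U *ᵥ v) i) = ∑ i, Complex.normSq (v i) := by
  rw [← dotProduct_star_self_re, ← dotProduct_star_self_re, star_mulVec, dotProduct_mulVec,
    vecMul_vecMul, ← star_eq_conjTranspose, mem_unitaryGroup_iff'.1 hU, vecMul_one]

/-- Polar decomposition for a matrix with orthogonal columns: normalize the nonzero columns and
complete them to an orthonormal basis. -/
theorem exists_unitary_of_orthogonal_columns {M : Matrix κ κ ℂ} {d : κ → ℂ}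
    (hM : Mᴴ * M = diagonal d) (hle : ∀ j, ∑ i, Complex.normSq (M i j) ≤ 1) :
    ∃ C ∈ unitaryGroup κ ℂ, (Mᴴ * M).trace.re ≤ (Cᴴ * M).trace.re := by
  let m : κ → EuclideanSpace ℂ κ := fun j => WithLp.toLp 2 fun i => M i j
  have hinner : ∀ (v : EuclideanSpace ℂ κ) j, inner ℂ v (m j) = ∑ i, star (v i) * M i j := by
    intro v j
    rw [PiLp.inner_apply]
    refine Finset.sum_congr rfl fun i _ => ?_
    simp [m, mul_comm]
  have hmm : ∀ i j, inner ℂ (m i) (m j) = diagonal d i j := by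
    intro i j
    rw [hinner, ← hM, mul_apply]
    rfl
  let s : Set κ := {j | m j ≠ 0}
  let v : κ → EuclideanSpace ℂ κ := fun j => ((‖m j‖⁻¹ : ℝ) : ℂ) • m j
  have hv : Orthonormal ℂ (s.domRestrict v) := by
    constructor
    · rintro ⟨j, hj⟩
      have : ‖m j‖ ≠ 0 := norm_ne_zero_iff.2 hj
      change ‖v j‖ = 1
      simp [v, norm_smul, this]
    · rintro ⟨i, hi⟩ ⟨j, hj⟩ hij
      have hij' : i ≠ j := fun h => hij (Subtype.ext h)
      change inner ℂ (v i) (v j) = 0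
      simp [v, hmm, diagonal_apply_ne _ hij']
  obtain ⟨c, hc⟩ := hv.exists_orthonormalBasis_extension_of_card_eq (by simp)
  refine ⟨of fun i j => c j i, ?_, ?_⟩
  · rw [mem_unitaryGroup_iff']
    ext i j
    have h := orthonormal_iff_ite.1 c.orthonormal i j
    rw [PiLp.inner_apply] at h
    rw [mul_apply, one_apply, ← h]
    refine Finset.sum_congr rfl fun x _ => ?_
    simp [mul_comm]
  · rw [trace, trace, Complex.re_sum, Complex.re_sum]
    refine Finset.sum_le_sum fun j _ => ?_
    have h1 : (Mᴴ * M).diag j = inner ℂ (m j) (m j) := by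
      rw [hmm, diag_apply, hM]
    have h2 : ((of fun i j => c j i : Matrix κ κ ℂ)ᴴ * M).diag j = inner ℂ (c j) (m j) := by
      rw [hinner]
      rfl
    have hn : ‖m j‖ ^ 2 ≤ 1 := by
      refine le_trans (le_of_eq ?_) (hle j)
      rw [EuclideanSpace.norm_sq_eq]
      simp [m, Complex.normSq_eq_norm_sq]
    have hn1 : ‖m j‖ ≤ 1 := by
      have := norm_nonneg (m j)
      nlinarith
    change ((Mᴴ * M).diag j).re ≤ (((of fun i j => c j i : Matrix κ κ ℂ)ᴴ * M).diag j).re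
    rw [h1, h2]
    by_cases hj : m j = 0
    · simp [hj]
    · have hne : ‖m j‖ ≠ 0 := norm_ne_zero_iff.2 hj
      have h3 : inner ℂ (m j) (m j) = ((‖m j‖ ^ 2 : ℝ) : ℂ) := by
        rw [inner_self_eq_norm_sq_to_K]
        norm_cast
      rw [hc j hj]
      simp only [v]
      rw [inner_smul_left, h3, Complex.conj_ofReal, ← Complex.ofReal_mul, Complex.ofReal_re,
        Complex.ofReal_re]
      have : ‖m j‖⁻¹ * ‖m j‖ ^ 2 = ‖m j‖ := by field_simp
      rw [this]
      have := norm_nonneg (m j)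
      nlinarith

/-- For a contraction `A` there is a unitary `W`, the unitary part of a polar decomposition of `A`,
with `Re Tr (W† A) = ‖A‖₁ ≥ ‖A‖_F²`. -/
theorem exists_unitary_trace_ge {A : Matrix κ κ ℂ}
    (hA : ∀ v, ∑ i, Complex.normSq ((A *ᵥ v) i) ≤ ∑ i, Complex.normSq (v i)) :
    ∃ W ∈ unitaryGroup κ ℂ,
      ∑ x, ∑ y, Complex.normSq (A x y) ≤ ∑ x, ∑ y, (star (W x y) * A x y).re := by
  have hH : (Aᴴ * A).IsHermitian := isHermitian_conjTranspose_mul_self A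
  let B : Matrix κ κ ℂ := (hH.eigenvectorUnitary : Matrix κ κ ℂ)
  have hBu : B ∈ unitaryGroup κ ℂ := hH.eigenvectorUnitary.2
  have hBB : B * Bᴴ = 1 := mem_unitaryGroup_iff.1 hBu
  have hBB' : Bᴴ * B = 1 := mem_unitaryGroup_iff'.1 hBu
  have hdiag : (A * B)ᴴ * (A * B) = diagonal (RCLike.ofReal ∘ hH.eigenvalues) := by
    have h := hH.conjStarAlgAut_star_eigenvectorUnitary
    rw [Unitary.conjStarAlgAut_star_apply] at h
    rw [← h, conjTranspose_mul]
    simp only [Matrix.mul_assoc]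
    rfl
  have hle : ∀ j, ∑ i, Complex.normSq ((A * B) i j) ≤ 1 := by
    intro j
    refine (hA fun i => B i j).trans (le_of_eq ?_)
    rw [← dotProduct_star_self_re]
    have h := congr_fun₂ hBB' j j
    rw [one_apply_eq] at h
    exact congr_arg Complex.re h
  obtain ⟨C, hC, hCM⟩ := exists_unitary_of_orthogonal_columns hdiag hle
  refine ⟨C * Bᴴ, mul_mem hC (Unitary.star_mem hBu), ?_⟩
  have h1 : ((A * B)ᴴ * (A * B)).trace = (Aᴴ * A).trace := by
    rw [conjTranspose_mul, Matrix.mul_assoc, trace_mul_comm, Matrix.mul_assoc, Matrix.mul_assoc,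
      hBB, Matrix.mul_one]
  have h2 : (Cᴴ * (A * B)).trace = ((C * Bᴴ)ᴴ * A).trace := by
    rw [conjTranspose_mul, conjTranspose_conjTranspose, Matrix.mul_assoc B, trace_mul_comm B,
      Matrix.mul_assoc]
  rw [h1, h2, trace_conjTranspose_mul_self_re] at hCM
  refine hCM.trans (le_of_eq ?_)
  rw [Finset.sum_comm, trace, Complex.re_sum]
  refine Finset.sum_congr rfl fun y _ => ?_
  rw [diag_apply, mul_apply, Complex.re_sum]
  rfl

/-- The normalized partial trace of a matrix over its second tensor factor. -/
noncomputable def reducedMatrix {α β : Type*} [Fintype β] (U : Matrix (α × β) (α × β) ℂ) :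
    Matrix α α ℂ :=
  fun a a' => (∑ z, U (a, z) (a', z)) / Fintype.card β

theorem reducedMatrix_contraction {α β : Type*} [Fintype α] [DecidableEq α] [Fintype β]
    [DecidableEq β] {U : Matrix (α × β) (α × β) ℂ} (hU : U ∈ unitaryGroup (α × β) ℂ) (v : α → ℂ) :
    ∑ a, Complex.normSq ((reducedMatrix U *ᵥ v) a) ≤ ∑ a, Complex.normSq (v a) := by
  rcases isEmpty_or_nonempty β with hβ | hβ
  · have : reducedMatrix U = 0 := by
      ext a a'
      simp [reducedMatrix]
    rw [this]
    simp only [zero_mulVec, Pi.zero_apply, map_zero, Finset.sum_const_zero]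
    exact Finset.sum_nonneg fun a _ => Complex.normSq_nonneg _
  have hβ0 : (0 : ℝ) < Fintype.card β := by exact_mod_cast Fintype.card_pos
  let u : β → α × β → ℂ := fun z x => if x.2 = z then v x.1 else 0
  have hentry : ∀ a, (reducedMatrix U *ᵥ v) a = (∑ z, (U *ᵥ u z) (a, z)) / Fintype.card β := by
    intro a
    simp only [mulVec, dotProduct, reducedMatrix, u, Fintype.sum_prod_type, mul_ite, mul_zero,
      Finset.sum_ite_eq', Finset.mem_univ, if_true]
    rw [Finset.sum_comm, Finset.sum_div]
    refine Finset.sum_congr rfl fun a' _ => ?_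
    rw [div_mul_eq_mul_div, Finset.sum_mul]
  have hcs : ∀ a, Complex.normSq ((reducedMatrix U *ᵥ v) a)
      ≤ (∑ z, Complex.normSq ((U *ᵥ u z) (a, z))) / Fintype.card β := by
    intro a
    rw [hentry, map_div₀, Complex.normSq_natCast, div_le_div_iff₀ (by positivity) hβ0]
    have h1 : Complex.normSq (∑ z, (U *ᵥ u z) (a, z))
        ≤ Fintype.card β * ∑ z, Complex.normSq ((U *ᵥ u z) (a, z)) := by
      simp only [Complex.normSq_eq_norm_sq]
      refine (pow_le_pow_left₀ (norm_nonneg _) (norm_sum_le _ _) 2).trans ?_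
      exact sq_sum_le_card_mul_sum_sq
    nlinarith
  refine (Finset.sum_le_sum fun a _ => hcs a).trans ?_
  rw [← Finset.sum_div, Finset.sum_comm, div_le_iff₀ hβ0]
  have hz : ∀ z, ∑ a, Complex.normSq ((U *ᵥ u z) (a, z)) ≤ ∑ a, Complex.normSq (v a) := by
    intro z
    calc ∑ a, Complex.normSq ((U *ᵥ u z) (a, z))
        ≤ ∑ a, ∑ z', Complex.normSq ((U *ᵥ u z) (a, z')) :=
          Finset.sum_le_sum fun a _ => Finset.single_le_sum
            (f := fun z' => Complex.normSq ((U *ᵥ u z) (a, z')))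
            (fun z' _ => Complex.normSq_nonneg _) (Finset.mem_univ z)
      _ = ∑ x, Complex.normSq (u z x) := by
          rw [← mulVec_unitary_normSq hU, Fintype.sum_prod_type]
      _ = ∑ a, Complex.normSq (v a) := by
          rw [Fintype.sum_prod_type]
          simp [u, apply_ite Complex.normSq]
  refine (Finset.sum_le_sum fun z _ => hz z).trans (le_of_eq ?_)
  simp [mul_comm]

end Contractions

/-! ### Pauli weight and distance from juntas -/

section Juntas

open Matrix

/-- Splitting of the computational basis labels into the qubits in `T` and the remaining ones. -/
def splitBits {n : ℕ} (T : Finset (Fin n)) :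
    Bits n ≃ (T → Fin 2) × ({i // i ∉ T} → Fin 2) :=
  Equiv.piEquivPiSubtypeProd (fun i => i ∈ T) fun _ => Fin 2

/-- The set of qubits on which the Pauli string `p` acts nontrivially. -/
def pauliSupport {n : ℕ} (p : Fin n → Fin 4) : Finset (Fin n) :=
  Finset.univ.filter fun i => p i ≠ 0

theorem pauliString_split {n : ℕ} (T : Finset (Fin n)) (p : Fin n → Fin 4) (x y : Bits n) :
    pauliString p x y
      = pauliString (fun i : T => p i) (splitBits T x).1 (splitBits T y).1
        * pauliString (fun i : {i // i ∉ T} => p i) (splitBits T x).2 (splitBits T y).2 := by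
  rw [pauliString, ← Fintype.prod_subtype_mul_prod_subtype (fun i => i ∈ T)]
  refine congr_arg₂ _ (Finset.prod_congr (by ext; simp) fun i _ => rfl) rfl

theorem pauliString_zero {ι : Type*} [Fintype ι] [DecidableEq ι] (x y : ι → Fin 2) :
    pauliString (fun _ => 0) x y = if x = y then 1 else 0 := by
  simp only [pauliString, pauli_zero, Matrix.one_apply]
  rw [Finset.prod_ite_zero]
  simp [funext_iff]

theorem sum_star_pauliString_diag {ι : Type*} [Fintype ι] [DecidableEq ι] {p : ι → Fin 4} {i : ι}
    (hi : p i ≠ 0) : ∑ z, star (pauliString p z z) = 0 := by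
  simp only [pauliString, star_prod]
  rw [← Fintype.piFinset_univ, ← Finset.prod_univ_sum (fun _ => Finset.univ)
    (fun i z => star (pauli (p i) z z))]
  exact Finset.prod_eq_zero (Finset.mem_univ i) (sum_star_pauli_diag hi)

theorem sum_splitBits {n : ℕ} (T : Finset (Fin n)) (F : Bits n → Bits n → ℂ) :
    ∑ x, ∑ y, F x y = ∑ a, ∑ a', ∑ z, ∑ z', F ((splitBits T).symm (a, z))
      ((splitBits T).symm (a', z')) := by
  have h : ∀ G : Bits n → ℂ, ∑ x, G x = ∑ a, ∑ z, G ((splitBits T).symm (a, z)) := fun G => by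
    rw [← (splitBits T).symm.sum_comp G, Fintype.sum_prod_type]
  rw [h]
  refine Finset.sum_congr rfl fun a _ => ?_
  rw [Finset.sum_congr rfl fun z _ => h _, Finset.sum_comm]

theorem two_pow_card_split {n : ℕ} (T : Finset (Fin n)) :
    (2 : ℂ) ^ n = 2 ^ Fintype.card T * 2 ^ Fintype.card {i // i ∉ T} := by
  rw [← pow_add, Fintype.card_subtype_compl (fun i => i ∈ T)]
  congr 1
  have := Fintype.card_subtype_le (fun i => i ∈ T)
  rw [Fintype.card_fin] at *
  omega

/-- The operator that `U` induces on the qubits in `T`. -/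
noncomputable def reducedOn {n : ℕ} (T : Finset (Fin n)) (U : Matrix (Bits n) (Bits n) ℂ) :
    Matrix (T → Fin 2) (T → Fin 2) ℂ :=
  reducedMatrix (U.submatrix (splitBits T).symm (splitBits T).symm)

theorem pauliCoeff_of_support_subset {n : ℕ} {T : Finset (Fin n)} {p : Fin n → Fin 4}
    (hp : ∀ i : {i // i ∉ T}, p i = 0) (U : Matrix (Bits n) (Bits n) ℂ) :
    pauliCoeff U p = pauliCoeff (reducedOn T U) (fun i : T => p i) := by
  have hp' : (fun i : {i // i ∉ T} => p i) = fun _ => 0 := funext hp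
  rw [pauliCoeff, pauliCoeff, Fintype.sum_prod_type, Fintype.sum_prod_type, sum_splitBits T,
    Fintype.card_fin, two_pow_card_split T, ← div_div, div_right_comm]
  congr 1
  rw [Finset.sum_div]
  refine Finset.sum_congr rfl fun a _ => ?_
  rw [Finset.sum_div]
  refine Finset.sum_congr rfl fun a' _ => ?_
  simp only [pauliString_split T p, hp', pauliString_zero, Equiv.apply_symm_apply, reducedOn,
    reducedMatrix, submatrix_apply, Fintype.card_fun, Fintype.card_fin, mul_ite, mul_one, mul_zero,
    apply_ite star, star_zero, ite_mul, zero_mul, Finset.sum_ite_eq, Finset.mem_univ, if_true]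
  rw [← Finset.mul_sum, mul_div_assoc]
  push_cast
  rfl

theorem supportMass_pauli {n : ℕ} (T : Finset (Fin n)) (U : Matrix (Bits n) (Bits n) ℂ) :
    supportMass (pauliWeight U) pauliSupport T
      = (∑ a, ∑ a', Complex.normSq (reducedOn T U a a')) / 2 ^ T.card := by
  have hsum := sum_pauliWeight (reducedOn T U)
  rw [Fintype.card_coe] at hsum
  let e := Equiv.piEquivPiSubtypeProd (fun i => i ∈ T) fun _ : Fin n => Fin 4
  rw [← hsum, supportMass, ← e.symm.sum_comp, Fintype.sum_prod_type]
  refine Finset.sum_congr rfl fun p _ => ?_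
  rw [Finset.sum_eq_single (fun _ => 0)]
  · have h0 : ∀ i : {i // i ∉ T}, e.symm (p, fun _ => 0) i = 0 := by
      intro i
      simp only [e, Equiv.piEquivPiSubtypeProd, Equiv.coe_fn_symm_mk, dif_neg i.2]
    have h1 : (fun i : T => e.symm (p, fun _ => 0) i) = p :=
      congr_arg Prod.fst (e.apply_symm_apply (p, fun _ => 0))
    rw [if_pos, pauliWeight, pauliCoeff_of_support_subset h0, h1, pauliWeight]
    intro i hi
    by_contra hiT
    exact (Finset.mem_filter.1 hi).2 (h0 ⟨i, hiT⟩)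
  · intro r _ hr
    rw [if_neg]
    intro hsub
    refine hr (funext fun i => ?_)
    by_contra hne
    refine i.2 (hsub (Finset.mem_filter.2 ⟨Finset.mem_univ _, ?_⟩))
    have h2 : e.symm (p, r) i = r i := by
      simp only [e, Equiv.piEquivPiSubtypeProd, Equiv.coe_fn_symm_mk, dif_neg i.2]
    rwa [h2]
  · simp

theorem pauliCoeff_junta_eq_zero {n : ℕ} {T : Finset (Fin n)} {V : QubitUnitary n}
    (hV : IsQuantumJuntaOn T V) {p : Fin n → Fin 4} (hp : ¬ pauliSupport p ⊆ T) :
    pauliCoeff (V : Matrix (Bits n) (Bits n) ℂ) p = 0 := by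
  obtain ⟨W, hW⟩ := hV
  obtain ⟨i, hi, hiT⟩ := Finset.not_subset.1 hp
  have hW' : ∀ a a' z z', (V : Matrix (Bits n) (Bits n) ℂ) ((splitBits T).symm (a, z))
      ((splitBits T).symm (a', z')) = W a a' * if z = z' then 1 else 0 := by
    intro a a' z z'
    have h1 : ∀ (a : T → Fin 2) (z : {i // i ∉ T} → Fin 2),
        (fun i : T => (splitBits T).symm (a, z) i) = a := fun a z =>
      congr_arg Prod.fst ((splitBits T).apply_symm_apply (a, z))
    have h2 : ∀ (a : T → Fin 2) (z : {i // i ∉ T} → Fin 2),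
        (fun i : {i // i ∉ T} => (splitBits T).symm (a, z) i) = z := fun a z =>
      congr_arg Prod.snd ((splitBits T).apply_symm_apply (a, z))
    rw [hW, h1, h1]
    congr 1
    refine if_congr ?_ rfl rfl
    conv_rhs => rw [← h2 a z, ← h2 a' z', funext_iff, Subtype.forall]
  rw [pauliCoeff, Fintype.sum_prod_type, sum_splitBits T]
  refine div_eq_zero_iff.2 (Or.inl ?_)
  refine Finset.sum_eq_zero fun a _ => Finset.sum_eq_zero fun a' _ => ?_
  have h3 := sum_star_pauliString_diag (p := fun i : {i // i ∉ T} => p i) (i := ⟨i, hiT⟩)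
    (Finset.mem_filter.1 hi).2
  simp only [hW', pauliString_split T p, Equiv.apply_symm_apply, mul_ite, mul_one, mul_zero,
    Finset.sum_ite_eq, Finset.mem_univ, if_true, star_mul']
  rw [← Finset.sum_mul, ← Finset.mul_sum, h3, mul_zero, zero_mul]

/-- A unitary close to a junta on `T` has little Fourier weight outside `T`. -/
theorem supportMass_ge_of_close {n : ℕ} {T : Finset (Fin n)} {U V : QubitUnitary n} {δ : ℝ}
    (hV : IsQuantumJuntaOn T V)
    (h : phaseDist (U : Matrix (Bits n) (Bits n) ℂ) (V : Matrix (Bits n) (Bits n) ℂ) ≤ δ) :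
    1 - 2 * δ ^ 2 ≤ supportMass (pauliWeight (U : Matrix (Bits n) (Bits n) ℂ)) pauliSupport T := by
  obtain ⟨θ, -, hθ⟩ := phaseDist_attained (U : Matrix (Bits n) (Bits n) ℂ)
    (V : Matrix (Bits n) (Bits n) ℂ)
  set c := Complex.exp ((θ : ℝ) * Complex.I)
  set D : Matrix (Bits n) (Bits n) ℂ := c • (U : Matrix (Bits n) (Bits n) ℂ) - V with hD
  have hc : Complex.normSq c = 1 := by
    rw [Complex.normSq_eq_norm_sq, Complex.norm_exp_ofReal_mul_I, one_pow]
  have hcard : (0 : ℝ) < Fintype.card (Bits n) := by exact_mod_cast Fintype.card_pos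
  have hcoeff : ∀ p, pauliCoeff D p = c * pauliCoeff (U : Matrix (Bits n) (Bits n) ℂ) p
      - pauliCoeff (V : Matrix (Bits n) (Bits n) ℂ) p := by
    intro p
    rw [pauliCoeff, pauliCoeff, pauliCoeff, ← mul_div_assoc, ← sub_div, Finset.mul_sum,
      ← Finset.sum_sub_distrib]
    congr 1
    refine Finset.sum_congr rfl fun z _ => ?_
    simp only [hD, Matrix.sub_apply, Matrix.smul_apply, smul_eq_mul]
    ring
  have hout : 1 - supportMass (pauliWeight (U : Matrix (Bits n) (Bits n) ℂ)) pauliSupport T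
      ≤ ∑ p, pauliWeight D p := by
    rw [← sum_pauliWeight_unitary U.2, supportMass, ← Finset.sum_sub_distrib]
    refine Finset.sum_le_sum fun p _ => ?_
    split_ifs with hp
    · rw [sub_self]
      exact pauliWeight_nonneg _ _
    · rw [sub_zero, pauliWeight, pauliWeight, hcoeff, pauliCoeff_junta_eq_zero hV hp, sub_zero,
        map_mul, hc, one_mul]
  have hpars : ∑ p, pauliWeight D p = frobNorm D ^ 2 / Fintype.card (Bits n) := by
    rw [sum_pauliWeight, frobNorm_sq]
    simp
  have hsq : frobNorm D ^ 2 / Fintype.card (Bits n) ≤ 2 * δ ^ 2 := by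
    have h0 : 0 ≤ frobNorm D / Real.sqrt (2 * (Fintype.card (Bits n) : ℝ)) :=
      div_nonneg (Real.sqrt_nonneg _) (Real.sqrt_nonneg _)
    rw [hθ] at h
    have h2 := pow_le_pow_left₀ h0 h 2
    rw [div_pow, Real.sq_sqrt (by positivity), div_le_iff₀ (by positivity)] at h2
    rw [div_le_iff₀ hcard]
    linarith
  linarith

theorem phaseDist_sq_le {κ : Type*} [Fintype κ] [DecidableEq κ] [Nonempty κ] {U V : Matrix κ κ ℂ}
    (hU : U ∈ unitaryGroup κ ℂ) (hV : V ∈ unitaryGroup κ ℂ) :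
    phaseDist U V ^ 2 ≤ 1 - (∑ x, ∑ y, (star (V x y) * U x y).re) / Fintype.card κ := by
  have hcard : (0 : ℝ) < Fintype.card κ := by exact_mod_cast Fintype.card_pos
  have hterm : ∀ θ : Set.Ico (0 : ℝ) (2 * Real.pi),
      0 ≤ frobNorm (Complex.exp ((θ : ℝ) * Complex.I) • U - V)
        / Real.sqrt (2 * (Fintype.card κ : ℝ)) :=
    fun θ => div_nonneg (Real.sqrt_nonneg _) (Real.sqrt_nonneg _)
  have hle : phaseDist U V ≤ frobNorm (U - V) / Real.sqrt (2 * (Fintype.card κ : ℝ)) := by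
    refine (ciInf_le ⟨0, ?_⟩ (⟨0, le_rfl, by positivity⟩ : Set.Ico (0 : ℝ) (2 * Real.pi))).trans
      (le_of_eq ?_)
    · rintro _ ⟨θ, rfl⟩
      exact hterm θ
    · simp
  refine (pow_le_pow_left₀ (Real.iInf_nonneg hterm) hle 2).trans (le_of_eq ?_)
  rw [div_pow, Real.sq_sqrt (by positivity), frobNorm_sq]
  have hexp : ∑ x, ∑ y, Complex.normSq ((U - V) x y)
      = Fintype.card κ + Fintype.card κ - 2 * ∑ x, ∑ y, (star (V x y) * U x y).re := by
    conv_rhs => rw [← sum_normSq_unitary hU]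
    conv_rhs => arg 1; arg 2; rw [sum_normSq_unitary hU, ← sum_normSq_unitary hV]
    simp only [Finset.mul_sum, ← Finset.sum_add_distrib, ← Finset.sum_sub_distrib]
    refine Finset.sum_congr rfl fun x _ => Finset.sum_congr rfl fun y _ => ?_
    rw [Matrix.sub_apply, Complex.normSq_sub, mul_comm (star _), Complex.star_def]
  rw [hexp]
  field_simp
  ring

/-- A unitary `U` far from all juntas on `T` has much Fourier weight outside `T`: the unitary part
of the operator induced by `U` on `T` gives a junta at squared distance at most that weight. -/
theorem exists_junta_phaseDist_sq_le {n : ℕ} (T : Finset (Fin n)) (U : QubitUnitary n) :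
    ∃ V : QubitUnitary n, IsQuantumJuntaOn T V ∧
      phaseDist (U : Matrix (Bits n) (Bits n) ℂ) (V : Matrix (Bits n) (Bits n) ℂ) ^ 2
        ≤ 1 - supportMass (pauliWeight (U : Matrix (Bits n) (Bits n) ℂ)) pauliSupport T := by
  have hsub : ∀ M ∈ unitaryGroup (Bits n) ℂ,
      M.submatrix (splitBits T).symm (splitBits T).symm
        ∈ unitaryGroup ((T → Fin 2) × ({i // i ∉ T} → Fin 2)) ℂ := by
    intro M hM
    rw [mem_unitaryGroup_iff, star_eq_conjTranspose, conjTranspose_submatrix,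
      submatrix_mul_equiv, ← star_eq_conjTranspose, mem_unitaryGroup_iff.1 hM, submatrix_one_equiv]
  obtain ⟨W, hW, hWge⟩ := exists_unitary_trace_ge (reducedMatrix_contraction (hsub U U.2))
  let K : Matrix ((T → Fin 2) × ({i // i ∉ T} → Fin 2)) ((T → Fin 2) × ({i // i ∉ T} → Fin 2)) ℂ :=
    W ⊗ₖ 1
  have hK : K ∈ unitaryGroup _ ℂ := kronecker_mem_unitary hW (one_mem _)
  have hVu : K.submatrix (splitBits T) (splitBits T) ∈ unitaryGroup (Bits n) ℂ := by
    rw [mem_unitaryGroup_iff, star_eq_conjTranspose, conjTranspose_submatrix,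
      submatrix_mul_equiv, ← star_eq_conjTranspose, mem_unitaryGroup_iff.1 hK, submatrix_one_equiv]
  refine ⟨⟨_, hVu⟩, ⟨W, fun x y => ?_⟩, (phaseDist_sq_le U.2 hVu).trans (le_of_eq_of_le rfl ?_)⟩
  · change W _ _ * (1 : Matrix ({i // i ∉ T} → Fin 2) ({i // i ∉ T} → Fin 2) ℂ) _ _ = _
    rw [Matrix.one_apply]
    congr 1
    refine if_congr ?_ rfl rfl
    rw [funext_iff, Subtype.forall]
    rfl
  · have hsum : ∑ x, ∑ y, star (K.submatrix (splitBits T) (splitBits T) x y)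
        * (U : Matrix (Bits n) (Bits n) ℂ) x y
        = 2 ^ Fintype.card {i // i ∉ T} * ∑ a, ∑ a', star (W a a') * reducedOn T U a a' := by
      rw [sum_splitBits T, Finset.mul_sum]
      refine Finset.sum_congr rfl fun a _ => ?_
      rw [Finset.mul_sum]
      refine Finset.sum_congr rfl fun a' _ => ?_
      simp only [submatrix_apply, Equiv.apply_symm_apply, K, kroneckerMap_apply, Matrix.one_apply,
        mul_ite, mul_one, mul_zero, apply_ite star, star_zero, ite_mul, zero_mul,
        Finset.sum_ite_eq, Finset.mem_univ, if_true, reducedOn, reducedMatrix, Fintype.card_fun,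
        Fintype.card_fin]
      rw [← Finset.mul_sum]
      push_cast
      field_simp
    have hre : ∑ x, ∑ y, (star (K.submatrix (splitBits T) (splitBits T) x y)
        * (U : Matrix (Bits n) (Bits n) ℂ) x y).re
        = 2 ^ Fintype.card {i // i ∉ T}
          * ∑ a, ∑ a', (star (W a a') * reducedOn T U a a').re := by
      have h := congr_arg Complex.re hsum
      have h2 : ((2 : ℂ) ^ Fintype.card {i // i ∉ T})
          = ((2 ^ Fintype.card {i // i ∉ T} : ℝ) : ℂ) := by push_cast; rfl
      rw [h2, Complex.re_ofReal_mul] at h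
      simpa only [Complex.re_sum] using h
    have hcard : ((Fintype.card (Bits n) : ℕ) : ℝ)
        = 2 ^ T.card * 2 ^ Fintype.card {i // i ∉ T} := by
      have h := two_pow_card_split T
      rw [Fintype.card_coe] at h
      rw [Fintype.card_fun, Fintype.card_fin, Fintype.card_fin]
      push_cast
      exact_mod_cast h
    rw [hre, hcard, supportMass_pauli, mul_comm ((2 : ℝ) ^ T.card), mul_div_mul_left _ _ (by positivity)]
    refine sub_le_sub_left ?_ 1
    exact div_le_div_of_nonneg_right hWge (by positivity)

end Juntas

/-! ### The tester -/

/-- The tester with `m` blocks of `b` Bell samples that accepts if some set of `k` qubits contains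
the supports of all samples in at least half of the blocks. For `b` about `4 / η`, it separates
weight at most `η / 32` outside some `T` from weight at least `η` outside every `T`. If `n < k` there
is no set of `k` qubits, hence no junta, and this tester always rejects. -/
theorem exists_blockTester {k m b : ℕ} {η : ℝ} (hm : 0 < m)
    (hsound : (49 * (m : ℝ)) ^ k * (2 / 7) ^ m ≤ 1 / 3) (hb1 : b * η ≤ 5)
    (hb2 : 4 ≤ b * η) (hη1 : η ≤ 1) (n : ℕ) :
    ∃ A : NonadaptiveTester n (m * b), ∀ U : QubitUnitary n,
      ((∃ T : Finset (Fin n), T.card = k ∧ 1 - η / 32 ≤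
        supportMass (pauliWeight (U : Matrix (Bits n) (Bits n) ℂ)) pauliSupport T) →
          2 / 3 ≤ A.acceptProb U) ∧
      ((∀ T : Finset (Fin n), T.card = k →
        supportMass (pauliWeight (U : Matrix (Bits n) (Bits n) ℂ)) pauliSupport T ≤ 1 - η) →
          2 / 3 ≤ A.rejectProb U) := by
  classical
  let e : (Fin (m * b) → Fin n → Fin 4) ≃ (Fin m → Fin b → Fin n → Fin 4) :=
    (finProdFinEquiv.arrowCongr (Equiv.refl _)).symm.trans (Equiv.curry _ _ _)
  let s : (Fin b → Fin n → Fin 4) → Finset (Fin n) :=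
    fun Z => Finset.univ.biUnion fun j => pauliSupport (Z j)
  let S : Finset (Fin (m * b) → Fin n → Fin 4) :=
    Finset.univ.filter fun σ => HalfCovered k fun i => s (e σ i)
  obtain ⟨A, hA⟩ := exists_bellSampling_tester n (m * b) S
  refine ⟨A, fun U => ?_⟩
  set w := pauliWeight (U : Matrix (Bits n) (Bits n) ℂ)
  have hw : ∀ p, 0 ≤ w p := pauliWeight_nonneg _
  have hw1 : ∑ p, w p = 1 := sum_pauliWeight_unitary U.2
  let w' : (Fin b → Fin n → Fin 4) → ℝ := fun Z => ∏ j, w (Z j)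
  have hw' : ∀ Z, 0 ≤ w' Z := fun Z => Finset.prod_nonneg fun j _ => hw _
  have hw1' : ∑ Z, w' Z = 1 := sum_prod_eq_one hw1
  have hmass : ∀ T, supportMass w' s T = supportMass w pauliSupport T ^ b := fun T =>
    supportMass_biUnion w pauliSupport T b
  have hmass0 : ∀ T, 0 ≤ supportMass w pauliSupport T := fun T =>
    Finset.sum_nonneg fun p _ => by split_ifs <;> simp [hw]
  have hprod : ∀ σ, ∏ t, w (σ t) = ∏ i, w' (e σ i) := by
    intro σ
    rw [← finProdFinEquiv.prod_comp, Fintype.prod_prod_type]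
    rfl
  have hacc : A.acceptProb U
      = ∑ Y : Fin m → Fin b → Fin n → Fin 4,
          (if HalfCovered k (fun i => s (Y i)) then ∏ i, w' (Y i) else 0) := by
    rw [(hA U).1, Finset.sum_filter, ← e.sum_comp]
    exact Finset.sum_congr rfl fun σ _ => by rw [hprod]
  have hrej : A.rejectProb U
      = ∑ Y : Fin m → Fin b → Fin n → Fin 4,
          (if HalfCovered k (fun i => s (Y i)) then 0 else ∏ i, w' (Y i)) := by
    rw [(hA U).2, Finset.compl_filter, Finset.sum_filter, ← e.sum_comp]
    exact Finset.sum_congr rfl fun σ _ => by rw [hprod, ite_not]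
  have htotal : A.acceptProb U + A.rejectProb U = 1 := by
    rw [hacc, hrej, ← Finset.sum_add_distrib, ← sum_prod_eq_one (κ := Fin m) hw1']
    exact Finset.sum_congr rfl fun Y _ => by split_ifs <;> simp
  constructor
  · rintro ⟨T, rfl, hT⟩
    have h1 := sum_not_halfCovered_le hw' hw1' s (T := T) hm
    rw [← hrej, hmass] at h1
    -- A block leaves `T` with probability at most `b * η / 32 ≤ 5 / 32`, so rejection has
    -- probability at most `10 / 32 < 1 / 3`.
    have h2 : 1 - 5 / 32 ≤ supportMass w pauliSupport T ^ b := by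
      have h3 := one_add_mul_le_pow (a := -(η / 32)) (by linarith) b
      have h4 := pow_le_pow_left₀ (show 0 ≤ 1 + -(η / 32) by linarith)
        (show 1 + -(η / 32) ≤ supportMass w pauliSupport T by linarith) b
      linarith
    linarith
  · intro hT
    have h1 := sum_halfCovered_le hw' hw1' s (k := k) hm fun T hTk => by
      rw [hmass]
      have h2 : supportMass w pauliSupport T ≤ Real.exp (-η) := by
        have := Real.add_one_le_exp (-η)
        linarith [hT T hTk]
      refine (pow_le_pow_left₀ (hmass0 T) h2 b).trans ?_
      have h7 : (7 : ℝ) ≤ Real.exp 2 := by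
        have h3 : (2.7 : ℝ) ^ 2 ≤ Real.exp 1 ^ 2 :=
          pow_le_pow_left₀ (by norm_num) (by linarith [Real.exp_one_gt_d9]) 2
        rw [← Real.exp_nat_mul] at h3
        norm_num at h3
        linarith
      have h49 : (49 : ℝ) ≤ Real.exp 4 := by
        rw [show (4 : ℝ) = 2 + 2 by norm_num, Real.exp_add]
        nlinarith
      calc Real.exp (-η) ^ b = Real.exp (-(b * η)) := by rw [← Real.exp_nat_mul, mul_neg]
        _ ≤ Real.exp (-4) := Real.exp_le_exp.2 (by linarith)
        _ ≤ 1 / 49 := by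
          rw [Real.exp_neg, inv_eq_one_div]
          exact one_div_le_one_div_of_le (by norm_num) h49
    rw [← hacc] at h1
    linarith

theorem theorem1 :
    ∃ C : ℝ, 0 < C ∧
      ∀ (ε ρ : ℝ) (k : ℕ), 0 < ε → ε < 1 → 0 < ρ → ρ < 1 → 1 ≤ k →
        ∃ q : ℕ,
          (q : ℝ) ≤ C * ((k : ℝ) * Real.log ((k : ℝ) + 1) / (ε ^ 2 * ρ * (1 - ρ) ^ k)) ∧
          ∀ n : ℕ, ∃ A : NonadaptiveTester n q, ∀ U : QubitUnitary n,
            (IsCloseToJunta k (Real.sqrt ρ / 8 * ε) U → 2 / 3 ≤ A.acceptProb U) ∧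
            (IsFarFromJuntas k ε U → 2 / 3 ≤ A.rejectProb U) := by
  -- `110 = 22 * 5`: at most `22 k log (k + 1)` blocks of at most `5 / ε ^ 2` samples each.
  refine ⟨110, by norm_num, fun ε ρ k hε0 hε1 hρ0 hρ1 hk => ?_⟩
  obtain ⟨m, hm, hmle, hsound⟩ := exists_block_count hk
  have hη0 : 0 < ε ^ 2 := by positivity
  have hη1 : ε ^ 2 ≤ 1 := pow_le_one₀ hε0.le hε1.le
  set b := ⌈4 / ε ^ 2⌉₊
  have hb2 : 4 ≤ b * ε ^ 2 := (div_le_iff₀ hη0).1 (Nat.le_ceil _)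
  have hb1 : b * ε ^ 2 ≤ 5 := by
    have h := (Nat.ceil_lt_add_one (show 0 ≤ 4 / ε ^ 2 by positivity)).le
    have h' := mul_le_mul_of_nonneg_right h hη0.le
    rw [add_mul, div_mul_cancel₀ _ hη0.ne'] at h'
    linarith
  refine ⟨m * b, ?_, fun n => ?_⟩
  · have hL : 0 ≤ (k : ℝ) * Real.log (k + 1) :=
      mul_nonneg k.cast_nonneg (Real.log_nonneg (by linarith [(k.cast_nonneg : (0 : ℝ) ≤ k)]))
    -- The factor `1 / (ρ (1 - ρ) ^ k) ≥ 1` in the allowed number of queries is not needed.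
    have hρk : ρ * (1 - ρ) ^ k ≤ 1 :=
      mul_le_one₀ hρ1.le (pow_nonneg (by linarith) _) (pow_le_one₀ (by linarith) (by linarith))
    have hden : 0 < ε ^ 2 * ρ * (1 - ρ) ^ k := by
      have : 0 < 1 - ρ := by linarith
      positivity
    rw [← mul_div_assoc, le_div_iff₀ hden]
    push_cast
    calc (m : ℝ) * b * (ε ^ 2 * ρ * (1 - ρ) ^ k)
        = m * (b * ε ^ 2) * (ρ * (1 - ρ) ^ k) := by ring
      _ ≤ m * (b * ε ^ 2) * 1 := by gcongr
      _ ≤ 22 * (k * Real.log (k + 1)) * 5 := by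
          rw [mul_one]
          gcongr
      _ = 110 * (k * Real.log (k + 1)) := by ring
  · obtain ⟨A, hA⟩ := exists_blockTester (k := k) hm hsound hb1 hb2 hη1 n
    refine ⟨A, fun U => ⟨?_, fun hfar => (hA U).2 fun T hT => ?_⟩⟩
    · rintro ⟨V, ⟨T, hT, hV⟩, hdist⟩
      refine (hA U).1 ⟨T, hT, ?_⟩
      have h := supportMass_ge_of_close hV hdist
      rw [mul_pow, div_pow, Real.sq_sqrt hρ0.le] at h
      nlinarith
    · obtain ⟨V, hV, hle⟩ := exists_junta_phaseDist_sq_le T U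
      have h := pow_le_pow_left₀ hε0.le (hfar V ⟨T, hT, hV⟩).le 2
      linarith
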